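/- Let $\mathcal D$ be a set. Let $\mathcal T$ be the set of plane rooted trees whose vertices are decorated by elements of $\mathcal D$, let $\mathcal F$ be the set of plane forests $F=t_1\cdots t_n$ (words in the elements of $\mathcal T$; the empty forest is $1$), and let $\mathcal H$ be the free associative $\mathbb Q$-algebra generated by $\mathcal T$, so that $\mathcal F$ is a $\mathbb Q$-basis of $\mathcal H$. An admissible cut $c$ of a tree $t$ is a set of edges of $t$ such that every ascending path meets at most one of them; $R^c(t)$ is the component of the root after the cut and $P^c(t)$ is the plane forest of the other components, in left-to-right order. In addition there is the total cut, with $P^c(t)=t$ and $R^c(t)=1$. A cut $c=(c_1,\dots,c_n)$ of a forest $t_1\cdots t_n$ is a choice of such a cut (possibly empty or total) of each $t_i$, with $P^c$ and $R^c$ the products of the $P^{c_i}(t_i)$ and of the $R^{c_i}(t_i)$. Let $\Delta:\mathcal H\to\mathcal H\otimes\mathcal H$ and $\varepsilon:\mathcal H\to\mathbb Q$ be the linear maps with $\Delta(F)=\sum_c P^c(F)\otimes R^c(F)$ and $\varepsilon(F)=\delta_{F,1}$ for $F\in\mathcal F$. For $d\in\mathcal D$ let $B_d^+:\mathcal H\to\mathcal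 H$ be the linear map that grafts the trees of a forest on a common new root decorated by $d$, and let $\gamma_d:\mathcal H\to\mathcal H$ be the linear map with $\gamma_d(1)=0$, $\gamma_d(t_1\cdots t_n)=t_1\cdots t_{n-1}$ if $t_n$ is the one-vertex tree decorated by $d$, and $\gamma_d(t_1\cdots t_n)=0$ otherwise. Let $\mathcal A$ be the subring of $\mathcal H$ generated by $\mathcal T$. Then $\varepsilon(\mathcal A)\subseteq\mathbb Z$, and $\Delta$ maps $\mathcal A$ into the subgroup of $\mathcal H\otimes\mathcal H$ generated by the elements $a\otimes b$ with $a,b\in\mathcal A$. There is a unique bilinear form $(\,,)$ on $\mathcal H$ such that for all $x,x_1,x_2,y\in\mathcal H$ and $d\in\mathcal D$ $$(1,x)=\varepsilon(x),\qquad (x_1x_2,y)=(x_1\otimes x_2,\Delta(y)),\qquad (B_d^+(x),y)=(x,\gamma_d(y)).$$ There is a unique family $(e_F)_{F\in\mathcal F}$ of elements of $\mathcal H$ such that $(e_F,G)=\delta_{F,G}$ for all $F,G\in\mathcal F$, and this family $(e_F)_{F\in\mathcal F}$ is a $\mathbb Z$-basis of $\mathcal A$. -/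

import Mathlib

open scoped TensorProduct

/-- Plane rooted trees decorated by `D`: a root with its decoration, and the ordered list of
the subtrees attached to the root. -/
inductive PTree (D : Type*) : Type _
  | node : D → List (PTree D) → PTree D

namespace PTree

variable {D : Type*}

/-- The tree with a single vertex decorated by `d`. -/
def dot (d : D) : PTree D := node d []

mutual
/-- All the ways of marking the vertices of a tree by a boolean.  The mark of a vertex `s` says
whether the edge arriving at `s` is cut.  No edge arrives at the root: marking the root
stands for the total cut, which has the whole tree as cut-off part and leaves the empty forest. -/
def cuts : PTree D → List (PTree (D × Bool))
  | node d ts => (cutsList ts).flatMap fun us => [node (d, false) us, node (d, true) us]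
/-- All the ways of marking the vertices of a forest. -/
def cutsList : List (PTree D) → List (List (PTree (D × Bool)))
  | [] => [[]]
  | t :: ts => (cuts t).flatMap fun u => (cutsList ts).map fun us => u :: us
end

mutual
/-- The largest number of marks on an ascending path of a marked tree. -/
def maxCuts : PTree (D × Bool) → ℕ
  | node x us => x.2.toNat + maxCutsList us
/-- The largest number of marks on an ascending path of a marked forest. -/
def maxCutsList : List (PTree (D × Bool)) → ℕ
  | [] => 0
  | u :: us => max (maxCuts u) (maxCutsList us)
end

mutual
/-- Forget the marks of a tree. -/
def unmark : PTree (D × Bool) → PTree D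
  | node x us => node x.1 (unmarkList us)
/-- Forget the marks of a forest. -/
def unmarkList : List (PTree (D × Bool)) → List (PTree D)
  | [] => []
  | u :: us => unmark u :: unmarkList us
end

mutual
/-- The plane forest cut off from a tree by an admissible cut, from left to right. -/
def pruned : PTree (D × Bool) → List (PTree D)
  | node x us => if x.2 then [node x.1 (unmarkList us)] else prunedList us
/-- The plane forest cut off from a forest by an admissible cut, from left to right. -/
def prunedList : List (PTree (D × Bool)) → List (PTree D)
  | [] => []
  | u :: us => pruned u ++ prunedList us
end

mutual
/-- What remains of a tree after an admissible cut: the component of the root, or the empty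
forest for the total cut. -/
def trunk : PTree (D × Bool) → List (PTree D)
  | node x us => if x.2 then [] else [node x.1 (trunkList us)]
/-- What remains of a forest after an admissible cut. -/
def trunkList : List (PTree (D × Bool)) → List (PTree D)
  | [] => []
  | u :: us => trunk u ++ trunkList us
end

/-- The admissible cuts of a forest (the empty and the total cut included): no ascending path
meets more than one cut.  Each one occurs exactly once in the list. -/
def admissibleCuts (F : List (PTree D)) : List (List (PTree (D × Bool))) :=
  (cutsList F).filter fun c => maxCutsList c ≤ 1

end PTree

/-- Plane rooted decorated forests: the monomials in the trees; `1` is the empty forest. -/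
abbrev PForest (D : Type*) := FreeMonoid (PTree D)

/-- The free associative algebra over `ℚ` generated by the trees. -/
abbrev HPR (D : Type*) := FreeAlgebra ℚ (PTree D)

noncomputable section

namespace HPR

variable {D : Type*}

/-- A forest, seen as a monomial of the free algebra. -/
def forest : PForest D →* HPR D := FreeMonoid.lift (FreeAlgebra.ι ℚ)

/-- The basis of the free algebra made of the forests. -/
def forestBasis (D : Type*) : Module.Basis (PForest D) ℚ (HPR D) :=
  FreeAlgebra.basisFreeMonoid ℚ (PTree D)

theorem forestBasis_apply (F : PForest D) : forestBasis D F = forest F := by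
  simp [forestBasis, FreeAlgebra.basisFreeMonoid, forest, FreeAlgebra.equivMonoidAlgebraFreeMonoid]

/-- The coproduct: `Δ(F) = ∑ P^c(F) ⊗ R^c(F)`, over all admissible cuts `c` of the forest `F`. -/
def coproduct : HPR D →ₗ[ℚ] HPR D ⊗[ℚ] HPR D :=
  (forestBasis D).constr ℚ fun F =>
    ((PTree.admissibleCuts F.toList).map fun c =>
      forest (FreeMonoid.ofList (PTree.prunedList c)) ⊗ₜ[ℚ]
        forest (FreeMonoid.ofList (PTree.trunkList c))).sum

open Classical in
/-- The counit: `1` on the empty forest, `0` on the other forests. -/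
def counit : HPR D →ₗ[ℚ] ℚ :=
  (forestBasis D).constr ℚ fun F => if F = 1 then 1 else 0

/-- The operator `B_d^+`: graft all the trees of a forest on a common root decorated by `d`. -/
def graft (d : D) : HPR D →ₗ[ℚ] HPR D :=
  (forestBasis D).constr ℚ fun F => FreeAlgebra.ι ℚ (PTree.node d F.toList)

open Classical in
/-- The operator `γ_d`: `t₁ ⋯ tₙ` is sent to `t₁ ⋯ tₙ₋₁` if `tₙ` is the one-vertex tree
decorated by `d`, and to `0` otherwise; `1` is sent to `0`. -/
def gamma (d : D) : HPR D →ₗ[ℚ] HPR D :=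
  (forestBasis D).constr ℚ fun F =>
    if F.toList.getLast? = some (PTree.dot d) then
      forest (FreeMonoid.ofList F.toList.dropLast) else 0

/-- The three properties that define the bilinear form `( , )`. -/
structure IsPairing (β : HPR D →ₗ[ℚ] HPR D →ₗ[ℚ] ℚ) : Prop where
  one_left : ∀ x, β 1 x = counit x
  /-- `(x₁ x₂, y) = (x₁ ⊗ x₂, Δ(y))` -/
  mul_left : ∀ x₁ x₂ y,
    β (x₁ * x₂) y = LinearMap.mul' ℚ ℚ (TensorProduct.map (β x₁) (β x₂) (coproduct y))
  graft_left : ∀ (d : D) x y, β (graft d x) y = β x (gamma d y)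

open Classical in
/-- `(e_F, G) = δ_{F,G}` for all forests `F` and `G`. -/
def IsDualFamily (β : HPR D →ₗ[ℚ] HPR D →ₗ[ℚ] ℚ) (e : PForest D → HPR D) : Prop :=
  ∀ F G : PForest D, β (e F) (forest G) = if F = G then 1 else 0

end HPR

/-- The subring of `HPR D` generated by the trees: the free algebra over `ℤ` on the trees. -/
def APR (D : Type*) : Subring (HPR D) :=
  Subring.closure (Set.range (FreeAlgebra.ι ℚ : PTree D → HPR D))

end

/-!
`HPR D` is initial among the algebras with a family of linear operators indexed by `D`, the trees
being generated from `1` by products and graftings. A form `( , )` with the three properties is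
therefore the same thing as the unique morphism from `HPR D` to its dual algebra, with the
convolution product of `Δ`, which turns `B_d^+` into the transpose `γ_d^*` of `γ_d`.

Let `ξ_F` be the coordinate form of the forest `F`. For forests `F` and `G` one has
`ξ_G * γ_d^*(ξ_F) = ξ_{F B_d^+(G)} + ∑_L n_L ξ_L`, with integers `n_L` and forests `L` which have
the decorations of `F B_d^+(G)` but a smaller last tree: cutting the last tree of a forest down to
its root leaves the most vertices above. So every `ξ_F` lies in the subring generated from `1`
by the operators `γ_d^*`, that is, in the image of the integral form `APR D`; this gives a dual
family in `APR D`. The pairing respects the decorations, and a given multiset of decorations is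
shared by finitely many forests only, so a dual family is a basis. Its coordinates `(x, F)` are
integers on `APR D`, hence it is a `ℤ`-basis of `APR D`.
-/

section DualBases

open Module

variable {R M ι κ : Type*} [CommRing R] [AddCommGroup M] [Module R M] {deg : ι → κ}

theorem dual_apply_eq_sum_fiber (b : Basis ι R M) {k : κ} {T : Finset ι}
    (hT : ∀ i, i ∈ T ↔ deg i = k) {f : Dual R M} (hf : ∀ j, deg j ≠ k → f (b j) = 0) (x : M) :
    f x = ∑ j ∈ T, f (b j) * b.repr x j := by
  classical
  suffices f = ∑ j ∈ T, f (b j) • b.coord j by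
    conv_lhs => rw [this]
    simp
  refine b.ext fun i => ?_
  by_cases hi : i ∈ T
  · simp [Finsupp.single_apply, hi]
  · simp [Finsupp.single_apply, hi, hf i (mt (hT i).2 hi)]

theorem eq_zero_of_dual_apply_eq_zero (b : Basis ι R M) (finite_fiber : ∀ k, (deg ⁻¹' {k}).Finite)
    {e : ι → M} {ε : ι → Dual R M} (ortho : ∀ i j, deg i ≠ deg j → ε i (b j) = 0)
    (eval_same : ∀ i, ε i (e i) = 1) (eval_of_ne : Pairwise fun i j => ε i (e j) = 0) {x : M}
    (hx : ∀ i, ε i x = 0) : x = 0 := by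
  classical
  refine b.ext_elem fun j => ?_
  let T : Finset ι := (finite_fiber (deg j)).toFinset
  have mem_T (i : ι) : i ∈ T ↔ deg i = deg j := by simp [T]
  have expand (i : T) (y : M) : ε i y = ∑ l : T, ε i (b l) * b.repr y l := by
    rw [Finset.sum_coe_sort T fun l => ε i (b l) * b.repr y l]
    refine dual_apply_eq_sum_fiber b mem_T (fun l hl => ortho i l ?_) y
    rw [(mem_T i).1 i.2]
    exact hl.symm
  let A : Matrix T T R := .of fun i l => ε i (b l)
  let E : Matrix T T R := .of fun l i => b.repr (e i) l
  have A_mul_E : A * E = 1 := by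
    ext i l
    rw [Matrix.mul_apply, Matrix.one_apply]
    refine (expand i (e l)).symm.trans ?_
    split_ifs with h
    · rw [h, eval_same]
    · exact eval_of_ne (Subtype.coe_ne_coe.2 h)
  have A_mulVec : A.mulVec (fun l : T => b.repr x l) = 0 := by
    ext i
    exact (expand i x).symm.trans (hx i)
  have repr_eq_zero : (fun l : T => b.repr x l) = 0 := by
    rw [← Matrix.one_mulVec fun l : T => b.repr x l, ← mul_eq_one_comm.1 A_mul_E,
      ← Matrix.mulVec_mulVec, A_mulVec, Matrix.mulVec_zero]
  simpa using congrFun repr_eq_zero ⟨j, (mem_T j).2 rfl⟩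

theorem dualBases_of_finite_fibers (b : Basis ι R M) (finite_fiber : ∀ k, (deg ⁻¹' {k}).Finite)
    {e : ι → M} {ε : ι → Dual R M} (ortho : ∀ i j, deg i ≠ deg j → ε i (b j) = 0)
    (eval_same : ∀ i, ε i (e i) = 1) (eval_of_ne : Pairwise fun i j => ε i (e j) = 0) :
    DualBases e ε where
  eval_same := eval_same
  eval_of_ne := eval_of_ne
  total h := sub_eq_zero.1 <|
    eq_zero_of_dual_apply_eq_zero b finite_fiber ortho eval_same eval_of_ne fun i => by
      rw [map_sub, h, sub_self]
  finite x := by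
    refine ((b.repr x).support.finite_toSet.biUnion fun j _ => finite_fiber (deg j)).subset ?_
    refine fun i => not_imp_comm.1 fun hi => ?_
    rw [← b.linearCombination_repr x, Finsupp.linearCombination_apply, map_finsuppSum]
    refine Finset.sum_eq_zero fun j hj => ?_
    have deg_ne : deg i ≠ deg j := fun h => hi (Set.mem_biUnion hj h)
    exact (map_smul (ε i) _ _).trans (by rw [ortho i j deg_ne, smul_zero])

end DualBases

namespace PTree

section CutSum

variable {D M : Type*} [AddCommMonoid M]

@[elab_as_elim]
theorem forest_induction {P : List (PTree D) → Prop} (nil : P [])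
    (cons : ∀ d ts r, P ts → P r → P (node d ts :: r)) : ∀ F, P F
  | [] => nil
  | node d ts :: r => cons d ts r (forest_induction nil cons ts) (forest_induction nil cons r)

/-- The sum of `φ (P^c(F)) (R^c(F))` over the admissible cuts `c` of the forest `F`. The forest is
the first argument, so that `cutSum F fun p q => …` reads as a sum over the terms `p ⊗ q` of
`Δ(F)`. -/
def cutSum (F : List (PTree D)) (φ : List (PTree D) → List (PTree D) → M) : M :=
  ((admissibleCuts F).map fun c => φ (prunedList c) (trunkList c)).sum

theorem cutSum_eq_sum_cutsList (F : List (PTree D)) (φ : List (PTree D) → List (PTree D) → M) :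
    cutSum F φ = ((cutsList F).map fun c =>
      if maxCutsList c ≤ 1 then φ (prunedList c) (trunkList c) else 0).sum := by
  simp [cutSum, admissibleCuts, List.sum_map_ite]

theorem sum_map_cutsList_cons (d : D) (ts r : List (PTree D))
    (f : List (PTree (D × Bool)) → M) :
    ((cutsList (node d ts :: r)).map f).sum =
      ((cutsList ts).map fun us =>
        ((cutsList r).map fun vs => f (node (d, true) us :: vs)).sum).sum +
      ((cutsList ts).map fun us =>
        ((cutsList r).map fun vs => f (node (d, false) us :: vs)).sum).sum := by
  rw [← List.sum_map_add]
  simp [cutsList, cuts, List.flatMap_def, List.sum_flatten, List.map_flatten, Function.comp_def,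
    add_comm]

theorem sum_map_cutsList_of_maxCutsList_eq_zero (F : List (PTree D)) (f : List (PTree D) → M) :
    ((cutsList F).map fun c => if maxCutsList c = 0 then f (unmarkList c) else 0).sum = f F := by
  induction F using forest_induction generalizing f with
  | nil => simp [cutsList, maxCutsList, unmarkList]
  | cons d ts r iht ihr =>
    have root_cut (us : List (PTree (D × Bool))) (vs : List (PTree (D × Bool))) :
        maxCutsList (node (d, true) us :: vs) ≠ 0 := by simp [maxCutsList, maxCuts]
    rw [sum_map_cutsList_cons, ← iht fun ts => f (node d ts :: r)]
    simp only [root_cut, if_false, List.map_const', List.sum_replicate, smul_zero, zero_add]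
    congr! 3 with us
    split_ifs with h
    · simpa [maxCutsList, maxCuts, unmarkList, unmark, h] using
        ihr fun r => f (node d (unmarkList us) :: r)
    · simp [maxCutsList, maxCuts, h]

@[simp]
theorem cutSum_nil (φ : List (PTree D) → List (PTree D) → M) : cutSum [] φ = φ [] [] := by
  simp [cutSum_eq_sum_cutsList, cutsList, maxCutsList, prunedList, trunkList]

@[simp]
theorem cutSum_zero (F : List (PTree D)) : cutSum F (fun _ _ => (0 : M)) = 0 := by
  simp [cutSum]

theorem cutSum_add (F : List (PTree D)) (φ ψ : List (PTree D) → List (PTree D) → M) :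
    (cutSum F fun p q => φ p q + ψ p q) = cutSum F φ + cutSum F ψ :=
  List.sum_map_add

theorem cutSum_mem {S : Type*} [SetLike S M] [AddSubmonoidClass S M] {s : S} (F : List (PTree D))
    {φ : List (PTree D) → List (PTree D) → M} (h : ∀ p q, φ p q ∈ s) : cutSum F φ ∈ s :=
  list_sum_mem (List.forall_mem_map.2 fun _ _ => h _ _)

theorem map_cutSum {N A : Type*} [AddCommMonoid N] [FunLike A M N] [AddMonoidHomClass A M N] (f : A)
    (F : List (PTree D)) (φ : List (PTree D) → List (PTree D) → M) :
    f (cutSum F φ) = cutSum F fun p q => f (φ p q) := by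
  simp [cutSum, map_list_sum, Function.comp_def]

theorem cutSum_comm (F G : List (PTree D))
    (φ : List (PTree D) → List (PTree D) → List (PTree D) → List (PTree D) → M) :
    (cutSum F fun p q => cutSum G fun p' q' => φ p q p' q') =
      cutSum G fun p' q' => cutSum F fun p q => φ p q p' q' := by
  unfold cutSum
  induction admissibleCuts F with
  | nil => simp
  | cons c l ih => simp only [List.map_cons, List.sum_cons, ih, List.sum_map_add]

theorem cutSum_node_cons (d : D) (ts r : List (PTree D))
    (φ : List (PTree D) → List (PTree D) → M) :
    cutSum (node d ts :: r) φ = (cutSum r fun p q => φ (node d ts :: p) q) +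
      cutSum ts fun p q => cutSum r fun p' q' => φ (p ++ p') (node d q :: q') := by
  rw [cutSum_eq_sum_cutsList, sum_map_cutsList_cons]
  congr 1
  · rw [← sum_map_cutsList_of_maxCutsList_eq_zero ts fun ts =>
      cutSum r fun p q => φ (node d ts :: p) q]
    congr! 3 with us
    split_ifs with h
    · simp [cutSum_eq_sum_cutsList, maxCutsList, maxCuts, prunedList, pruned, trunkList, trunk, h]
    · simp [maxCutsList, maxCuts, h]
  · rw [cutSum_eq_sum_cutsList ts]
    congr! 3 with us
    split_ifs with h
    · simp [cutSum_eq_sum_cutsList, maxCutsList, maxCuts, prunedList, pruned, trunkList, trunk, h]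
    · simp [maxCutsList, maxCuts, h]

theorem cutSum_append (F G : List (PTree D)) (φ : List (PTree D) → List (PTree D) → M) :
    cutSum (F ++ G) φ =
      cutSum F fun p q => cutSum G fun p' q' => φ (p ++ p') (q ++ q') := by
  induction F using forest_induction generalizing φ with
  | nil => simp
  | cons d ts r _ ihr => simp [cutSum_node_cons, ihr]

theorem cutSum_coassoc (F : List (PTree D))
    (φ : List (PTree D) → List (PTree D) → List (PTree D) → M) :
    (cutSum F fun p q => cutSum p fun p₁ p₂ => φ p₁ p₂ q) =
      cutSum F fun p q => cutSum q fun q₁ q₂ => φ p q₁ q₂ := by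
  induction F using forest_induction generalizing φ with
  | nil => simp
  | cons d ts r iht ihr =>
    have uncut :
        (cutSum r fun p q => cutSum ts fun a b => cutSum p fun p₁ p₂ =>
            φ (a ++ p₁) (node d b :: p₂) q) =
          cutSum ts fun a b => cutSum r fun p q => cutSum q fun q₁ q₂ =>
            φ (a ++ p) (node d b :: q₁) q₂ := by
      rw [cutSum_comm]
      exact congrArg (cutSum ts) (funext₂ fun a b =>
        ihr fun p₁ p₂ q => φ (a ++ p₁) (node d b :: p₂) q)
    have cut :=
      calc cutSum ts fun a b => cutSum r fun p q => cutSum a fun a₁ a₂ => cutSum p fun p₁ p₂ =>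
            φ (a₁ ++ p₁) (a₂ ++ p₂) (node d b :: q)
        _ = cutSum ts fun a b => cutSum a fun a₁ a₂ => cutSum r fun p q => cutSum p fun p₁ p₂ =>
              φ (a₁ ++ p₁) (a₂ ++ p₂) (node d b :: q) :=
            congrArg (cutSum ts) (funext₂ fun a b => cutSum_comm ..)
        _ = cutSum ts fun a b => cutSum b fun b₁ b₂ => cutSum r fun p q => cutSum p fun p₁ p₂ =>
              φ (a ++ p₁) (b₁ ++ p₂) (node d b₂ :: q) :=
            iht fun a₁ a₂ b => cutSum r fun p q => cutSum p fun p₁ p₂ =>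
              φ (a₁ ++ p₁) (a₂ ++ p₂) (node d b :: q)
        _ = cutSum ts fun a b => cutSum b fun b₁ b₂ => cutSum r fun p q => cutSum q fun q₁ q₂ =>
              φ (a ++ p) (b₁ ++ q₁) (node d b₂ :: q₂) :=
            congrArg (cutSum ts) (funext₂ fun a b => congrArg (cutSum b) (funext₂ fun b₁ b₂ =>
              ihr fun p₁ p₂ q => φ (a ++ p₁) (b₁ ++ p₂) (node d b₂ :: q)))
        _ = cutSum ts fun a b => cutSum r fun p q => cutSum b fun b₁ b₂ => cutSum q fun q₁ q₂ =>
              φ (a ++ p) (b₁ ++ q₁) (node d b₂ :: q₂) :=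
            congrArg (cutSum ts) (funext₂ fun a b => cutSum_comm ..)
    simp only [cutSum_node_cons, cutSum_append, cutSum_add]
    rw [ihr fun p₁ p₂ q => φ (node d ts :: p₁) p₂ q, uncut, cut, add_assoc]

theorem cutSum_eq_apply_nil_right (F : List (PTree D)) {φ : List (PTree D) → List (PTree D) → M}
    (h : ∀ p q, q ≠ [] → φ p q = 0) : cutSum F φ = φ F [] := by
  induction F using forest_induction generalizing φ with
  | nil => simp
  | cons d ts r _ ihr =>
    rw [cutSum_node_cons, ihr fun p q => h _ q]
    simp [h]

theorem cutSum_eq_apply_nil_left (F : List (PTree D)) {φ : List (PTree D) → List (PTree D) → M}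
    (h : ∀ p q, p ≠ [] → φ p q = 0) : cutSum F φ = φ [] F := by
  induction F using forest_induction generalizing φ with
  | nil => simp
  | cons d ts r iht ihr =>
    have trunk_root : (cutSum r fun p q => φ p (node d ts :: q)) = φ [] (node d ts :: r) :=
      ihr fun p _ => h p _
    rw [cutSum_node_cons, iht] <;> simp +contextual [h, trunk_root]

end CutSum

section Decorations

variable {D : Type*}

/-- The multiset of the decorations of the vertices of a forest: the grading which cuts and the
pairing respect. -/
def decorations : List (PTree D) → Multiset D
  | [] => 0
  | node d ts :: r => d ::ₘ (decorations ts + decorations r)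

@[simp]
theorem decorations_nil : decorations ([] : List (PTree D)) = 0 := by
  rw [decorations]

@[simp]
theorem decorations_node_cons (d : D) (ts r : List (PTree D)) :
    decorations (node d ts :: r) = d ::ₘ (decorations ts + decorations r) := by
  rw [decorations]

@[simp]
theorem decorations_append (F G : List (PTree D)) :
    decorations (F ++ G) = decorations F + decorations G := by
  induction F using forest_induction with
  | nil => simp
  | cons d ts r _ ihr => simp [ihr, add_assoc]

@[simp]
theorem decorations_eq_zero {F : List (PTree D)} : decorations F = 0 ↔ F = [] := by
  rcases F with _ | ⟨⟨d, ts⟩, r⟩ <;> simp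

theorem finite_setOf_decorations_eq (m : Multiset D) :
    {F : List (PTree D) | decorations F = m}.Finite := by
  suffices finite_le : {F : List (PTree D) | decorations F ≤ m}.Finite from
    finite_le.subset fun F hF => le_of_eq hF
  induction m using Multiset.strongInductionOn with
  | ih m ih =>
    classical
    refine ((Set.finite_singleton []).union (m.toFinset.finite_toSet.biUnion fun d hd =>
      .image2 (fun ts r => node d ts :: r)
        (ih (m.erase d) (Multiset.erase_lt.2 (by simpa using hd)))
        (ih (m.erase d) (Multiset.erase_lt.2 (by simpa using hd))))).subset ?_
    rintro (_ | ⟨⟨d, ts⟩, r⟩) h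
    · exact .inl rfl
    · have hd : d ∈ m := Multiset.mem_of_le h (by simp)
      have h' : decorations ts + decorations r ≤ m.erase d := by
        rwa [Set.mem_ofPred_eq, decorations_node_cons, ← Multiset.cons_erase hd,
          Multiset.cons_le_cons_iff] at h
      refine .inr (Set.mem_biUnion (by simpa using hd) ⟨ts, ?_, r, ?_, rfl⟩)
      · exact (Multiset.le_add_right ..).trans h'
      · exact (Multiset.le_add_left ..).trans h'

theorem cutSum_eq_zero {M : Type*} [AddCommMonoid M] (F : List (PTree D))
    {φ : List (PTree D) → List (PTree D) → M}
    (h : ∀ p q, decorations p + decorations q = decorations F → φ p q = 0) :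
    cutSum F φ = 0 := by
  induction F using forest_induction generalizing φ with
  | nil => simpa using h
  | cons d ts r iht ihr =>
    rw [cutSum_node_cons, ihr, iht, add_zero]
    · intro p q hts
      refine ihr fun p' q' hr => h _ _ ?_
      simp only [decorations_append, decorations_node_cons, ← hts, ← hr, Multiset.add_cons]
      congr 1
      abel
    · intro p q hr
      exact h _ _ (by simp [← hr, add_assoc])

/-- Induction on the decorations of a forest, then on the number of vertices of its last tree. -/
theorem concat_induction {P : List (PTree D) → Prop} (nil : P [])
    (concat : ∀ F d G, P F → P G →
      (∀ H d' K, decorations (H ++ [node d' K]) = decorations (F ++ [node d G]) →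
        (decorations K).card < (decorations G).card → P (H ++ [node d' K])) →
      P (F ++ [node d G])) (F : List (PTree D)) : P F := by
  induction hm : decorations F using Multiset.strongInductionOn generalizing F with
  | ih m ihm =>
    obtain rfl | ⟨F, ⟨d, G⟩, rfl⟩ := F.eq_nil_or_concat'
    · exact nil
    · induction hn : (decorations G).card using Nat.strong_induction_on generalizing F d G with
      | h n ihn =>
        have lt_m : decorations F + decorations G < m := by
          simpa [← hm] using Multiset.lt_cons_self _ d
        refine concat F d G (ihm _ ((Multiset.le_add_right ..).trans_lt lt_m) F rfl)
          (ihm _ ((Multiset.le_add_left ..).trans_lt lt_m) G rfl) fun H d' K hH hK => ?_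
        exact ihn _ (hn ▸ hK) H d' K (hH.trans hm) rfl

end Decorations

end PTree

noncomputable section

namespace HPR

open PTree WithConv

variable {D : Type*}

section Coalgebra

/-- A forest given by its list of trees, seen as an element of `HPR D`. -/
def monomial (F : List (PTree D)) : HPR D := forest (FreeMonoid.ofList F)

theorem forest_eq_monomial (F : PForest D) : forest F = monomial F.toList := rfl

theorem forestBasis_ofList (F : List (PTree D)) :
    forestBasis D (FreeMonoid.ofList F) = monomial F :=
  forestBasis_apply _

@[simp]
theorem monomial_nil : (monomial [] : HPR D) = 1 := map_one forest

theorem monomial_append (F G : List (PTree D)) :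
    monomial (F ++ G) = monomial F * monomial G :=
  map_mul forest _ _

theorem monomial_singleton (t : PTree D) : monomial [t] = FreeAlgebra.ι ℚ t :=
  FreeMonoid.lift_eval_of _ t

theorem linearMap_ext {M : Type*} [AddCommMonoid M] [Module ℚ M] {f g : HPR D →ₗ[ℚ] M}
    (h : ∀ F, f (monomial F) = g (monomial F)) : f = g :=
  (forestBasis D).ext fun F => by
    simpa only [forestBasis_apply, forest_eq_monomial] using h F.toList

theorem coproduct_monomial (F : List (PTree D)) :
    coproduct (monomial F) = cutSum F fun p q => monomial p ⊗ₜ[ℚ] monomial q := by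
  rw [← forestBasis_ofList, coproduct, Module.Basis.constr_basis]
  rfl

theorem counit_monomial (F : List (PTree D)) :
    counit (monomial F) = if F = [] then 1 else 0 := by
  rw [← forestBasis_ofList, counit, Module.Basis.constr_basis]
  classical exact if_congr Iff.rfl rfl rfl

@[simp]
theorem graft_monomial (d : D) (F : List (PTree D)) :
    graft d (monomial F) = monomial [node d F] := by
  rw [← forestBasis_ofList, graft, Module.Basis.constr_basis, monomial_singleton]
  rfl

theorem monomial_node_cons (d : D) (ts r : List (PTree D)) :
    monomial (node d ts :: r) = graft d (monomial ts) * monomial r := by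
  rw [graft_monomial, ← monomial_append, List.singleton_append]

@[simp]
theorem gamma_one (d : D) : gamma d 1 = 0 := by
  rw [← monomial_nil, ← forestBasis_ofList, gamma, Module.Basis.constr_basis]
  rfl

open Classical in
theorem gamma_monomial_concat (d d' : D) (F G : List (PTree D)) :
    gamma d (monomial (F ++ [node d' G])) = if d' = d ∧ G = [] then monomial F else 0 := by
  rw [← forestBasis_ofList, gamma, Module.Basis.constr_basis, monomial]
  exact if_congr (by simp [dot]) (by simp) rfl

theorem cutSum_tmul {M N : Type*} [AddCommMonoid M] [Module ℚ M] [AddCommMonoid N] [Module ℚ N]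
    (F : List (PTree D)) (φ : List (PTree D) → List (PTree D) → M) (y : N) :
    cutSum F φ ⊗ₜ[ℚ] y = cutSum F fun p q => φ p q ⊗ₜ[ℚ] y :=
  map_cutSum ((TensorProduct.mk ℚ M N).flip y) F φ

theorem tmul_cutSum {M N : Type*} [AddCommMonoid M] [Module ℚ M] [AddCommMonoid N] [Module ℚ N]
    (F : List (PTree D)) (x : M) (φ : List (PTree D) → List (PTree D) → N) :
    x ⊗ₜ[ℚ] cutSum F φ = cutSum F fun p q => x ⊗ₜ[ℚ] φ p q :=
  map_cutSum (TensorProduct.mk ℚ M N x) F φ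

instance : Coalgebra ℚ (HPR D) where
  comul := coproduct
  counit := counit
  coassoc := linearMap_ext fun F => by
    simpa [coproduct_monomial, map_cutSum, cutSum_tmul, tmul_cutSum] using
      cutSum_coassoc F fun p q r => (monomial p ⊗ₜ[ℚ] (monomial q ⊗ₜ[ℚ] monomial r) :
        HPR D ⊗[ℚ] (HPR D ⊗[ℚ] HPR D))
  rTensor_counit_comp_comul := linearMap_ext fun F => by
    simp only [LinearMap.comp_apply, coproduct_monomial, map_cutSum, LinearMap.rTensor_tmul,
      counit_monomial]
    rw [cutSum_eq_apply_nil_left] <;> simp +contextual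
  lTensor_counit_comp_comul := linearMap_ext fun F => by
    simp only [LinearMap.comp_apply, coproduct_monomial, map_cutSum, LinearMap.lTensor_tmul,
      counit_monomial]
    rw [cutSum_eq_apply_nil_right] <;> simp +contextual

end Coalgebra

section IntegralForm

theorem monomial_mem_APR (F : List (PTree D)) : monomial F ∈ APR D := by
  induction F with
  | nil => exact monomial_nil (D := D) ▸ one_mem _
  | cons t r ih =>
    rw [← List.singleton_append, monomial_append, monomial_singleton]
    exact mul_mem (Subring.subset_closure ⟨t, rfl⟩) ih

theorem map_mem_of_mem_APR {M A : Type*} [AddCommGroup M] [FunLike A (HPR D) M]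
    [AddMonoidHomClass A (HPR D) M] (f : A) {S : AddSubgroup M}
    (h : ∀ F, f (monomial F) ∈ S) {x : HPR D} (hx : x ∈ APR D) : f x ∈ S := by
  rw [APR, Subring.mem_closure_iff, ← FreeMonoid.mrange_lift] at hx
  have forests_le : AddSubgroup.closure (MonoidHom.mrange (forest (D := D)) : Set (HPR D)) ≤
      S.comap (f : HPR D →+ M) := by
    rw [AddSubgroup.closure_le]
    rintro _ ⟨F, rfl⟩
    exact h F.toList
  exact forests_le hx

theorem graft_mem_APR (d : D) {x : HPR D} (hx : x ∈ APR D) : graft d x ∈ APR D :=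
  map_mem_of_mem_APR (graft d) (S := (APR D).toAddSubgroup)
    (fun F => graft_monomial d F ▸ monomial_mem_APR _) hx

theorem exists_counit_eq_intCast {x : HPR D} (hx : x ∈ APR D) : ∃ n : ℤ, counit x = n := by
  suffices counit x ∈ (Int.castAddHom ℚ).range from this.imp fun n hn => hn.symm
  refine map_mem_of_mem_APR counit (fun F => ?_) hx
  exact ⟨if F = [] then 1 else 0, by simp [counit_monomial]⟩

theorem coproduct_mem_closure {x : HPR D} (hx : x ∈ APR D) :
    coproduct x ∈ AddSubgroup.closure {z | ∃ a ∈ APR D, ∃ b ∈ APR D, z = a ⊗ₜ[ℚ] b} := by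
  refine map_mem_of_mem_APR coproduct (fun F => ?_) hx
  rw [coproduct_monomial]
  exact cutSum_mem F fun p q => AddSubgroup.subset_closure
    ⟨_, monomial_mem_APR p, _, monomial_mem_APR q, rfl⟩

end IntegralForm

section GraftLift

variable {A : Type*}

mutual
/-- The value on a tree of the algebra morphism `graftLift L`. -/
def liftTree [Monoid A] (L : D → A → A) : PTree D → A
  | node d ts => L d (liftForest L ts)
/-- The value on a forest of the algebra morphism `graftLift L`. -/
def liftForest [Monoid A] (L : D → A → A) : List (PTree D) → A
  | [] => 1
  | t :: ts => liftTree L t * liftForest L ts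
end

variable [Semiring A] [Algebra ℚ A] (L : D → A →ₗ[ℚ] A)

/-- The algebra morphism given by the universal property of `HPR D`: it is initial among the
algebras with a family, indexed by `D`, of linear endomorphisms. -/
def graftLift : HPR D →ₐ[ℚ] A := FreeAlgebra.lift ℚ (liftTree fun d => L d)

theorem graftLift_monomial (F : List (PTree D)) :
    graftLift L (monomial F) = liftForest (fun d => L d) F := by
  induction F with
  | nil => simp [liftForest]
  | cons t r ih =>
    rw [← List.singleton_append, monomial_append, monomial_singleton, map_mul, ih,
      List.singleton_append, liftForest, graftLift, FreeAlgebra.lift_ι_apply]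

theorem graftLift_graft (d : D) (x : HPR D) : graftLift L (graft d x) = L d (graftLift L x) := by
  suffices (graftLift L).toLinearMap ∘ₗ graft d = L d ∘ₗ (graftLift L).toLinearMap from
    LinearMap.congr_fun this x
  refine linearMap_ext fun F => ?_
  simp [graftLift_monomial, liftForest, liftTree]

theorem eq_graftLift {f : HPR D →ₐ[ℚ] A} (h : ∀ d x, f (graft d x) = L d (f x)) :
    f = graftLift L := by
  suffices f.toLinearMap = (graftLift L).toLinearMap from AlgHom.toLinearMap_injective this
  refine linearMap_ext fun F => ?_
  induction F using forest_induction with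
  | nil => simp
  | cons d ts r iht ihr =>
    simp only [AlgHom.toLinearMap_apply] at iht ihr ⊢
    rw [monomial_node_cons, map_mul, map_mul, h, graftLift_graft, iht, ihr]

theorem graftLift_mem {A : Type*} [Ring A] [Algebra ℚ A] {L : D → A →ₗ[ℚ] A} {S : Subring A}
    (hS : ∀ d, ∀ a ∈ S, L d a ∈ S) {x : HPR D} (hx : x ∈ APR D) : graftLift L x ∈ S := by
  refine map_mem_of_mem_APR (graftLift L) (S := S.toAddSubgroup) (fun F => ?_) hx
  induction F using forest_induction with
  | nil => simp
  | cons d ts r iht ihr =>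
    rw [monomial_node_cons, map_mul, graftLift_graft]
    exact S.mul_mem (hS d _ iht) ihr

end GraftLift

section Dual

/-- The dual algebra of the coalgebra `HPR D`: the linear forms on `HPR D`, with the convolution
product `(f * g)(F) = ∑_c f(P^c(F)) g(R^c(F))`. -/
abbrev DualAlgebra (D : Type*) := WithConv (HPR D →ₗ[ℚ] ℚ)

theorem comul_eq_coproduct : (Coalgebra.comul : HPR D →ₗ[ℚ] HPR D ⊗[ℚ] HPR D) = coproduct := rfl

theorem convMul_monomial (f g : DualAlgebra D) (F : List (PTree D)) :
    (f * g) (monomial F) = cutSum F fun p q => f (monomial p) * g (monomial q) := by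
  simp [comul_eq_coproduct, coproduct_monomial, map_cutSum]

theorem convOne_monomial (F : List (PTree D)) :
    (1 : DualAlgebra D) (monomial F) = if F = [] then 1 else 0 :=
  counit_monomial F

theorem dualAlgebra_ext {f g : DualAlgebra D} (h : ∀ F, f (monomial F) = g (monomial F)) :
    f = g :=
  WithConv.ext (linearMap_ext h)

/-- The transpose of `γ_d`. -/
def gammaDual (d : D) : DualAlgebra D →ₗ[ℚ] DualAlgebra D where
  toFun f := toConv (f.ofConv ∘ₗ gamma d)
  map_add' _ _ := rfl
  map_smul' _ _ := rfl

theorem gammaDual_apply (d : D) (f : DualAlgebra D) (x : HPR D) :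
    gammaDual d f x = f (gamma d x) := rfl

/-- The morphism to the dual algebra under which `B_d^+` becomes the transpose of `γ_d`. -/
def pairingHom : HPR D →ₐ[ℚ] DualAlgebra D := graftLift gammaDual

/-- The pairing `( , )` of `HPR D` with itself: `(x, ·)` is the form `pairingHom x`. -/
def pairing : HPR D →ₗ[ℚ] HPR D →ₗ[ℚ] ℚ :=
  (WithConv.linearEquiv ℚ (HPR D →ₗ[ℚ] ℚ)).toLinearMap ∘ₗ pairingHom.toLinearMap

theorem pairing_apply (x y : HPR D) : pairing x y = pairingHom x y := rfl

theorem isPairing_pairing : IsPairing (pairing (D := D)) where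
  one_left x := by rw [pairing_apply, map_one]; rfl
  mul_left x₁ x₂ y := by rw [pairing_apply, map_mul]; rfl
  graft_left d x y := by rw [pairing_apply, pairingHom, graftLift_graft]; rfl

theorem IsPairing.eq_pairing {β : HPR D →ₗ[ℚ] HPR D →ₗ[ℚ] ℚ} (hβ : IsPairing β) :
    β = pairing := by
  let f : HPR D →ₐ[ℚ] DualAlgebra D :=
    AlgHom.ofLinearMap ((WithConv.linearEquiv ℚ (HPR D →ₗ[ℚ] ℚ)).symm.toLinearMap ∘ₗ β)
      (WithConv.ext (LinearMap.ext hβ.one_left))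
      fun x₁ x₂ => WithConv.ext (LinearMap.ext (hβ.mul_left x₁ x₂))
  have f_eq : f = pairingHom :=
    eq_graftLift gammaDual fun d x => WithConv.ext (LinearMap.ext (hβ.graft_left d x))
  exact LinearMap.ext fun x => congrArg ofConv (DFunLike.congr_fun f_eq x)

end Dual

section Coord

/-- The forms which take integral values on the forests. -/
def integralForms (D : Type*) : Subring (DualAlgebra D) where
  carrier := {f | ∀ F, f (monomial F) ∈ (Int.castRingHom ℚ).range}
  zero_mem' _ := zero_mem _
  one_mem' F := by
    rw [convOne_monomial]
    split_ifs
    exacts [one_mem _, zero_mem _]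
  add_mem' hf hg F := add_mem (hf F) (hg F)
  neg_mem' hf F := neg_mem (hf F)
  mul_mem' hf hg F := by
    rw [convMul_monomial]
    exact cutSum_mem F fun p q => mul_mem (hf p) (hg q)

theorem gammaDual_mem_integralForms (d : D) {f : DualAlgebra D} (hf : f ∈ integralForms D) :
    gammaDual d f ∈ integralForms D := by
  classical
  intro F
  rw [gammaDual_apply]
  obtain rfl | ⟨F, ⟨d', G⟩, rfl⟩ := F.eq_nil_or_concat'
  · simp
  · rw [gamma_monomial_concat]
    split_ifs
    · exact hf F
    · simp

theorem exists_pairing_eq_intCast {x : HPR D} (hx : x ∈ APR D) (F : List (PTree D)) :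
    ∃ n : ℤ, pairing x (monomial F) = n :=
  (graftLift_mem (fun d _ => gammaDual_mem_integralForms d) hx F).imp fun _ => Eq.symm

theorem pairing_monomial_eq_zero {F G : List (PTree D)} (h : decorations F ≠ decorations G) :
    pairing (monomial F) (monomial G) = 0 := by
  induction F using forest_induction generalizing G with
  | nil =>
    rw [monomial_nil, isPairing_pairing.one_left, counit_monomial, if_neg]
    rintro rfl
    exact h rfl
  | cons d ts r iht ihr =>
    have graft_eq_zero {p : List (PTree D)} (hp : d ::ₘ decorations ts ≠ decorations p) :
        pairing (graft d (monomial ts)) (monomial p) = 0 := by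
      classical
      rw [isPairing_pairing.graft_left]
      obtain rfl | ⟨p, ⟨d', q⟩, rfl⟩ := p.eq_nil_or_concat'
      · simp
      · rw [gamma_monomial_concat]
        split_ifs with hq
        · obtain ⟨rfl, rfl⟩ := hq
          exact iht fun hts => hp (by simp [hts, ← Multiset.singleton_add, add_comm])
        · exact map_zero _
    rw [monomial_node_cons, pairing_apply, map_mul, convMul_monomial]
    refine cutSum_eq_zero G fun p q hpq => ?_
    by_cases hp : d ::ₘ decorations ts = decorations p
    · refine mul_eq_zero_of_right _ (ihr fun hq => h ?_)
      rw [← hpq, ← hp, ← hq, decorations_node_cons, Multiset.cons_add]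
    · exact mul_eq_zero_of_left (graft_eq_zero hp) _

/-- The coordinate form of the forest `F` in the basis of the forests. -/
def coord (F : List (PTree D)) : DualAlgebra D :=
  toConv ((forestBasis D).coord (FreeMonoid.ofList F))

open Classical in
theorem coord_monomial (F G : List (PTree D)) :
    coord F (monomial G) = if F = G then 1 else 0 := by
  rw [← forestBasis_ofList]
  simp [coord, Finsupp.single_apply, eq_comm]

theorem coord_nil : coord [] = (1 : DualAlgebra D) :=
  dualAlgebra_ext fun F => by simp only [coord_monomial, convOne_monomial, eq_comm]

theorem gammaDual_coord (d : D) (F : List (PTree D)) :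
    gammaDual d (coord F) = coord (F ++ [node d []]) := by
  classical
  refine dualAlgebra_ext fun G => ?_
  obtain rfl | ⟨G, ⟨d', H⟩, rfl⟩ := G.eq_nil_or_concat'
  · rw [gammaDual_apply, coord_monomial, monomial_nil, gamma_one]
    simp
  · rw [gammaDual_apply, gamma_monomial_concat, coord_monomial]
    split_ifs <;> simp_all [coord_monomial]

theorem coord_mem_integralForms (F : List (PTree D)) : coord F ∈ integralForms D := by
  classical
  intro G
  rw [coord_monomial]
  split_ifs
  exacts [one_mem _, zero_mem _]

theorem decorations_eq_of_coord_mul_coord_ne_zero {F G L : List (PTree D)}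
    (h : (coord F * coord G) (monomial L) ≠ 0) :
    decorations L = decorations F + decorations G := by
  classical
  contrapose! h
  rw [convMul_monomial]
  refine cutSum_eq_zero L fun p q hpq => ?_
  simp only [coord_monomial]
  split_ifs <;> simp_all

theorem coord_mul_coord_concat_monomial {G K : List (PTree D)}
    (hGK : (decorations G).card ≤ (decorations K).card) (F H : List (PTree D)) (d d' : D) :
    (coord G * coord (F ++ [node d []])) (monomial (H ++ [node d' K])) =
      coord (F ++ [node d G]) (monomial (H ++ [node d' K])) := by
  classical
  have uncut (p : List (PTree D)) : G ≠ p ++ [node d' K] := by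
    rintro rfl
    simp at hGK
  have not_append {p : List (PTree D)} (hp : p ≠ []) : G ≠ p ++ K := by
    rintro rfl
    simp_all
  have cut_last (p q : List (PTree D)) : (cutSum [node d' K] fun p' q' =>
      coord G (monomial (p ++ p')) * coord (F ++ [node d []]) (monomial (q ++ q'))) =
      coord G (monomial (p ++ K)) * coord (F ++ [node d []]) (monomial (q ++ [node d' []])) := by
    rw [cutSum_node_cons, cutSum_nil, coord_monomial, if_neg (uncut p), zero_mul, zero_add]
    simp only [cutSum_nil, List.append_nil]
    refine cutSum_eq_apply_nil_right K fun k l hl => ?_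
    rw [coord_monomial (F ++ _), if_neg, mul_zero]
    simp [hl.symm]
  rw [convMul_monomial, cutSum_append]
  simp only [cut_last]
  rw [cutSum_eq_apply_nil_left]
  · simp only [coord_monomial, List.nil_append]
    split_ifs <;> simp_all
  · intro p q hp
    rw [coord_monomial, if_neg (not_append hp), zero_mul]

theorem exists_eq_concat_of_coord_mul_coord_sub_coord_ne_zero {F G L : List (PTree D)} {d : D}
    (h : (coord G * coord (F ++ [node d []]) - coord (F ++ [node d G])) (monomial L) ≠ 0) :
    decorations L = decorations (F ++ [node d G]) ∧
      ∃ H d' K, L = H ++ [node d' K] ∧ (decorations K).card < (decorations G).card := by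
  classical
  rw [ofConv_sub, LinearMap.sub_apply] at h
  have decorations_eq : decorations L = decorations (F ++ [node d G]) := by
    by_contra hL
    rw [coord_monomial, if_neg (ne_of_apply_ne _ (Ne.symm hL)), sub_zero] at h
    refine hL ((decorations_eq_of_coord_mul_coord_ne_zero h).trans ?_)
    simp only [decorations_append, decorations_node_cons, decorations_nil,
      ← Multiset.singleton_add]
    abel
  refine ⟨decorations_eq, ?_⟩
  obtain rfl | ⟨H, ⟨d', K⟩, rfl⟩ := L.eq_nil_or_concat'
  · simp at decorations_eq
  · refine ⟨H, d', K, rfl, lt_of_not_ge fun hGK => h ?_⟩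
    rw [coord_mul_coord_concat_monomial hGK, sub_self]

theorem eq_sum_coord {f : DualAlgebra D} {T : Finset (List (PTree D))}
    (h : ∀ F, f (monomial F) ≠ 0 → F ∈ T) : f = ∑ F ∈ T, f (monomial F) • coord F := by
  classical
  refine dualAlgebra_ext fun G => ?_
  simp only [ofConv_sum, ofConv_smul, LinearMap.sum_apply, LinearMap.smul_apply, coord_monomial,
    smul_eq_mul, mul_ite, mul_one, mul_zero, Finset.sum_ite_eq']
  split_ifs with hG
  · rfl
  · exact not_imp_comm.1 (h G) hG

theorem mem_of_coord_mem {S : Subring (DualAlgebra D)} {f : DualAlgebra D}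
    (hf : f ∈ integralForms D) {m : Multiset D}
    (hm : ∀ F, f (monomial F) ≠ 0 → decorations F = m)
    (hS : ∀ F, f (monomial F) ≠ 0 → coord F ∈ S) : f ∈ S := by
  classical
  rw [eq_sum_coord (f := f) (T := (finite_setOf_decorations_eq m).toFinset) (by simpa using hm)]
  refine sum_mem fun F _ => ?_
  by_cases h0 : f (monomial F) = 0
  · simp [h0]
  · obtain ⟨n, hn⟩ := hf F
    rw [← hn, eq_intCast, Int.cast_smul_eq_zsmul]
    exact zsmul_mem (hS F h0) n

theorem coord_mem {S : Subring (DualAlgebra D)} (hS : ∀ d, ∀ f ∈ S, gammaDual d f ∈ S)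
    (F : List (PTree D)) : coord F ∈ S := by
  classical
  induction F using concat_induction with
  | nil => exact coord_nil (D := D) ▸ one_mem S
  | concat F d G hF hG lower =>
    let f := coord G * coord (F ++ [node d []])
    have f_mem : f ∈ S := S.mul_mem hG (gammaDual_coord d F ▸ hS d _ hF)
    suffices f - coord (F ++ [node d G]) ∈ S by simpa using S.sub_mem f_mem this
    refine mem_of_coord_mem (sub_mem (mul_mem ?_ ?_) ?_)
      (fun L hL => (exists_eq_concat_of_coord_mul_coord_sub_coord_ne_zero hL).1) fun L hL => ?_
    iterate 3 exact coord_mem_integralForms _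
    obtain ⟨hm, H, d', K, rfl, hKG⟩ := exists_eq_concat_of_coord_mul_coord_sub_coord_ne_zero hL
    exact lower H d' K hm hKG

end Coord

section DualFamily

theorem exists_mem_APR_pairing_eq_coord (F : List (PTree D)) :
    ∃ x ∈ APR D, ∀ G, pairing x (monomial G) = coord F (monomial G) := by
  let S : Subring (DualAlgebra D) := (APR D).map (pairingHom (D := D)).toRingHom
  have gammaDual_mem (d : D) (f : DualAlgebra D) (hf : f ∈ S) : gammaDual d f ∈ S := by
    obtain ⟨x, hx, rfl⟩ := hf
    exact ⟨graft d x, graft_mem_APR d hx, graftLift_graft gammaDual d x⟩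
  obtain ⟨x, hx, hxF⟩ := coord_mem gammaDual_mem F
  exact ⟨x, hx, fun G => congrArg (fun f : DualAlgebra D => f (monomial G)) hxF⟩

theorem exists_isDualFamily_mem_APR :
    ∃ e : PForest D → HPR D, IsDualFamily pairing e ∧ ∀ F, e F ∈ APR D := by
  choose e e_mem pairing_e using exists_mem_APR_pairing_eq_coord (D := D)
  refine ⟨fun F => e F.toList, fun F G => ?_, fun F => e_mem _⟩
  rw [forest_eq_monomial, pairing_e, coord_monomial]
  classical exact if_congr Iff.rfl rfl rfl

theorem IsDualFamily.dualBases {e : PForest D → HPR D} (he : IsDualFamily pairing e) :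
    Module.DualBases e fun F => pairing.flip (forest F) := by
  refine dualBases_of_finite_fibers (forestBasis D)
    (deg := fun F : PForest D => decorations F.toList) finite_setOf_decorations_eq
    (fun F G h => ?_) (fun F => (he F F).trans (if_pos rfl))
    fun F G h => (he G F).trans (if_neg h.symm)
  rw [LinearMap.flip_apply, forestBasis_apply]
  exact pairing_monomial_eq_zero h.symm

theorem IsDualFamily.unique {e e' : PForest D → HPR D} (he : IsDualFamily pairing e)
    (he' : IsDualFamily pairing e') : e = e' :=
  funext fun F => he.dualBases.total fun G => (he F G).trans (he' F G).symm

theorem IsDualFamily.mem_APR {e : PForest D → HPR D} (he : IsDualFamily pairing e)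
    (F : PForest D) : e F ∈ APR D := by
  obtain ⟨e', he', e'_mem⟩ := exists_isDualFamily_mem_APR (D := D)
  exact he.unique he' ▸ e'_mem F

theorem IsDualFamily.closure_range {e : PForest D → HPR D} (he : IsDualFamily pairing e) :
    (APR D).toAddSubgroup = AddSubgroup.closure (Set.range e) := by
  refine le_antisymm (fun x hx => ?_) ?_
  · rw [← Submodule.span_int_eq_addSubgroupClosure, ← he.dualBases.coe_basis]
    refine (Module.Basis.mem_span_iff_repr_mem ℤ _ _).2 fun F => ?_
    exact (exists_pairing_eq_intCast hx F.toList).imp fun _ => Eq.symm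
  · rw [AddSubgroup.closure_le, Set.range_subset_iff]
    exact he.mem_APR

theorem IsDualFamily.exists_basis {e : PForest D → HPR D} (he : IsDualFamily pairing e) :
    ∃ b : Module.Basis (PForest D) ℤ (APR D), ∀ F, (b F : HPR D) = e F := by
  have closure_range := he.closure_range
  rw [← he.dualBases.coe_basis] at closure_range ⊢
  exact ⟨he.dualBases.basis.addSubgroupOfClosure _ closure_range,
    he.dualBases.basis.addSubgroupOfClosure_apply _ closure_range⟩

end DualFamily

end HPR

end

theorem mainTheorem5 (D : Type*) :
    (∀ x ∈ APR D, (∃ n : ℤ, HPR.counit x = n) ∧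
      HPR.coproduct x ∈ AddSubgroup.closure
        {z | ∃ a ∈ APR D, ∃ b ∈ APR D, z = a ⊗ₜ[ℚ] b}) ∧
    (∃! β : HPR D →ₗ[ℚ] HPR D →ₗ[ℚ] ℚ, HPR.IsPairing β) ∧
    ∀ β : HPR D →ₗ[ℚ] HPR D →ₗ[ℚ] ℚ, HPR.IsPairing β →
      (∃! e : PForest D → HPR D, HPR.IsDualFamily β e) ∧
      ∀ e : PForest D → HPR D, HPR.IsDualFamily β e →
        ∃ b : Module.Basis (PForest D) ℤ (APR D), ∀ F : PForest D, (b F : HPR D) = e F := by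
  refine ⟨fun x hx => ⟨HPR.exists_counit_eq_intCast hx, HPR.coproduct_mem_closure hx⟩,
    ⟨HPR.pairing, HPR.isPairing_pairing, fun β hβ => hβ.eq_pairing⟩, fun β hβ => ?_⟩
  obtain rfl := hβ.eq_pairing
  obtain ⟨e, he, -⟩ := HPR.exists_isDualFamily_mem_APR (D := D)
  exact ⟨⟨e, he, fun e' he' => he'.unique he⟩, fun e' he' => he'.exists_basis⟩
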